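/- For an integer $N\ge 1$, $\lambda\in\mathbb{C}$ and $u\in\mathbb{R}^N$ define functions $F_N(\lambda;t,u)$ recursively by $F_1(\lambda;t,u)=e^{itu}$ and, for $N>1$, $$F_N(\lambda;t,u)=\frac{e^{iu_N(t_1+\cdots+t_N)}}{(N-1)!}\int_{\mathbb{R}^{N-1}} W_{N-1}(\lambda;s)\,\mathcal{K}_N^\sharp(\lambda;t,s)\,F_{N-1}\big(\lambda;s,(u_1-u_N,\ldots,u_{N-1}-u_N)\big)\,ds,$$ where $$W_{n}(\lambda;s)=\prod_{1\le j<k\le n}\big[4\sinh^2(s_j-s_k)\big]^{\lambda},\qquad \mathcal{K}_N^\sharp(\lambda;t,s)=\prod_{j=1}^N\prod_{k=1}^{N-1}\big[2\cosh(t_j-s_k)\big]^{-\lambda},$$ with principal branches of the powers. Put $\Lambda_1=\{\lambda\in\mathbb{C}:\operatorname{Re}\lambda>1\}$ and $\mathcal{A}_N=\{t\in\mathbb{C}^N:\max_{1\le j<k\le N}|\operatorname{Im}(t_j-t_k)|<\pi\}$ (so $\mathcal{A}_1=\mathbb{C}$). Let $N\ge 1$ and $u\in\mathbb{R}^N$.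 Then, for $N>1$, the integral defining $F_N(\lambda;t,u)$ converges absolutely whenever $\operatorname{Re}\lambda\ge 1$ and $|\operatorname{Im}t_j|<\pi/2$ for $j=1,\ldots,N$ (in particular for $t\in\mathbb{R}^N$). Moreover $F_N(\lambda;t,u)$ is holomorphic in $(\lambda,t)$ on $\Lambda_1\times\mathcal{A}_N$, in the following sense: there is a holomorphic function on $\Lambda_1\times\mathcal{A}_N$ that coincides with $F_N(\lambda;t,u)$ whenever $\lambda\in\Lambda_1$ and $|\operatorname{Im}t_j|<\pi/2$ for all $j$, and it is the only holomorphic function on $\Lambda_1\times\mathcal{A}_N$ that coincides with $F_N(\lambda;t,u)$ for all $\lambda\in\Lambda_1$ and $t\in\mathbb{R}^N$. -/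

import Mathlib

open MeasureTheory

namespace HypCM

noncomputable section

/-- The half plane `Λ_κ = {λ ∈ ℂ : Re λ > κ}`. -/
def Lam (κ : ℝ) : Set ℂ := {lam | κ < lam.re}

/-- The domain `𝒜_N = {t ∈ ℂ^N : max_{j<k} |Im (t_j - t_k)| < π}` (all of `ℂ` if `N = 1`). -/
def domA (N : ℕ) : Set (Fin N → ℂ) :=
  {t | ∀ j k : Fin N, j < k → |(t j - t k).im| < Real.pi}

/-- The polystrip `|Im t_j| < π/2`, `j = 1, …, N`; it contains `ℝ^N`. -/
def polystrip (N : ℕ) : Set (Fin N → ℂ) := {t | ∀ j, |(t j).im| < Real.pi / 2}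

/-- The weight `W_n(λ; s) = ∏_{j<k} [4 sinh² (s_j - s_k)]^λ` at real `s`; the base of every power
is a nonnegative real. -/
def weight {n : ℕ} (lam : ℂ) (s : Fin n → ℝ) : ℂ :=
  ∏ j : Fin n, ∏ k ∈ Finset.Ioi j, ((4 * Real.sinh (s j - s k) ^ 2 : ℝ) : ℂ) ^ lam

/-- The kernel `𝒦_N^♯(λ; t, s) = ∏_{j=1}^{N} ∏_{k=1}^{N-1} [2 cosh (t_j - s_k)]^{-λ}`, `N = n + 1`,
at real `s`. For `t` in the polystrip, `2 cosh (t_j - s_k)` has positive real part and the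
principal branch of the power is the one that is positive for real `t` and `λ`. -/
def kernelSharp {n : ℕ} (lam : ℂ) (t : Fin (n + 1) → ℂ) (s : Fin n → ℝ) : ℂ :=
  ∏ j : Fin (n + 1), ∏ k : Fin n, (2 * Complex.cosh (t j - (s k : ℂ))) ^ (-lam)

/-- The integrand `W_{N-1}(λ; s) 𝒦_N^♯(λ; t, s) F_{N-1}(s, (u_1 - u_N, …, u_{N-1} - u_N))`,
`N = n + 1`, for a given function `Fprev = F_{N-1}(λ; ·, ·)`. -/
def stepIntegrand {n : ℕ} (Fprev : (Fin n → ℂ) → (Fin n → ℝ) → ℂ) (lam : ℂ)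
    (t : Fin (n + 1) → ℂ) (u : Fin (n + 1) → ℝ) (s : Fin n → ℝ) : ℂ :=
  weight lam s * kernelSharp lam t s *
    Fprev (fun k => (s k : ℂ)) (fun k => u k.castSucc - u (Fin.last n))

/-- The functions `F_N(λ; t, u)`, given by `F_1(t, u) = exp (i t u)` and, for `N > 1`, by
`F_N = exp (i u_N (t_1 + ⋯ + t_N)) / (N-1)! * ∫_{ℝ^{N-1}} W_{N-1} 𝒦_N^♯ F_{N-1} ds`.
This is meant for `Re λ ≥ 1` and `t` in the polystrip (in particular for real `t`). The value for
`N = 0` is a convention that the recursion does not use. -/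
def F : (N : ℕ) → ℂ → (Fin N → ℂ) → (Fin N → ℝ) → ℂ
  | 0, _, _, _ => 1
  | 1, _, t, u => Complex.exp (Complex.I * t 0 * (u 0 : ℂ))
  | n + 2, lam, t, u =>
      Complex.exp (Complex.I * (u (Fin.last (n + 1)) : ℂ) * ∑ j, t j) / ((n + 1).factorial : ℂ) *
        ∫ s : Fin (n + 1) → ℝ, stepIntegrand (F (n + 1) lam) lam t u s

/-- The integrand `I_N(λ; t, u, s)` that defines `F_N`, `N = n + 1`. -/
def integrand (n : ℕ) (lam : ℂ) (t : Fin (n + 1) → ℂ) (u : Fin (n + 1) → ℝ) (s : Fin n → ℝ) : ℂ :=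
  stepIntegrand (F n lam) lam t u s

end

end HypCM

namespace HypCM

noncomputable section

/-! Put a = Re λ, S = `spread` and K = ∑ |Re t_j - s_k|. The weight grows at most like exp(a S(s))
and the kernel decays like exp(-a K). By induction on N, at real points F_N decays almost like
exp(-a S(t) / 2). This rests on S(s) + S(t) ≤ 2 K (`spread_add_spread_le`): if P and Q count the t_j
and s_k that are ≤ r, then 2 K - S(s) - S(t) is the integral over r of 2 (P - Q) (P - Q - 1), which
is nonnegative because P - Q is an integer. That inequality by itself shows no decay in s; giving up
a small part θ of the rate and using `card_mul_spread_le` supplies it (`exponent_le`).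

The same estimate dominates the integrand locally uniformly on the polystrip, so F is holomorphic
there. Since F(t + y) = exp(i y ∑ u_j) F(t) for real y, the function exp(i z ∑ u_j) F(t - z) does
not depend on z as long as t - z stays in the polystrip; every t in 𝒜_N has such a z, which gives
the continuation. Uniqueness is the identity theorem on a complex line that meets ℝ^N in a real line
and passes through t. -/

/-! ### Distances between n and n + 1 points on the line -/

/-- The sum of `|s_j - s_k|` over all ordered pairs of indices. -/
def spread {n : ℕ} (s : Fin n → ℝ) : ℝ := ∑ j, ∑ k, |s j - s k|

theorem spread_nonneg {n : ℕ} (s : Fin n → ℝ) : 0 ≤ spread s :=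
  Finset.sum_nonneg fun _ _ => Finset.sum_nonneg fun _ _ => abs_nonneg _

/-- The value at `r` of the indicator function of the half line `[x, ∞)`. -/
def step (r x : ℝ) : ℝ := if x ≤ r then 1 else 0

theorem step_sub_sq_eq_indicator (x y r : ℝ) :
    (step r x - step r y) ^ 2 = (Set.Ico (min x y) (max x y)).indicator (fun _ => (1 : ℝ)) r := by
  simp only [step, Set.indicator, Set.mem_Ico, min_le_iff, lt_max_iff]
  by_cases hx : x ≤ r <;> by_cases hy : y ≤ r <;> simp [hx, hy, not_lt.mpr, not_le.mp]

theorem integrable_step_sub_sq (x y : ℝ) :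
    Integrable (fun r => (step r x - step r y) ^ 2) := by
  simp only [step_sub_sq_eq_indicator]
  exact (integrable_indicator_iff measurableSet_Ico).mpr (integrableOn_const (by simp))

theorem integral_step_sub_sq (x y : ℝ) : ∫ r, (step r x - step r y) ^ 2 = |x - y| := by
  simp only [step_sub_sq_eq_indicator]
  rw [integral_indicator measurableSet_Ico]
  simp [max_sub_min_eq_abs']

theorem sum_sum_sub_sq {ι κ : Type*} [Fintype ι] [Fintype κ] (p : ι → ℝ) (q : κ → ℝ)
    (hp : ∀ i, p i ^ 2 = p i) (hq : ∀ i, q i ^ 2 = q i) :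
    ∑ i, ∑ j, (p i - q j) ^ 2 =
      Fintype.card κ * ∑ i, p i + Fintype.card ι * ∑ j, q j - 2 * (∑ i, p i) * ∑ j, q j := by
  have h : ∀ i j, (p i - q j) ^ 2 = p i + q j - 2 * p i * q j := fun i j => by
    rw [sub_sq, hp, hq]; ring
  simp only [h, Finset.sum_sub_distrib, Finset.sum_add_distrib, Finset.sum_const,
    Finset.card_univ, nsmul_eq_mul, ← Finset.mul_sum, ← Finset.sum_mul]

/-- `n` points and `n + 1` points on the line: the mutual distances inside the two groups add up
to at most the distances between the groups. -/
theorem spread_add_spread_le {n : ℕ} (t : Fin (n + 1) → ℝ) (s : Fin n → ℝ) :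
    spread s + spread t ≤ 2 * ∑ j, ∑ k, |t j - s k| := by
  simp only [spread, ← integral_step_sub_sq]
  have I : ∀ {m l : ℕ} (x : Fin m → ℝ) (y : Fin l → ℝ),
      Integrable (fun r => ∑ j, ∑ k, (step r (x j) - step r (y k)) ^ 2) := fun x y =>
    integrable_finsetSum _ fun _ _ => integrable_finsetSum _ fun _ _ => integrable_step_sub_sq _ _
  have E : ∀ {m l : ℕ} (x : Fin m → ℝ) (y : Fin l → ℝ),
      ∑ j, ∑ k, ∫ r, (step r (x j) - step r (y k)) ^ 2 =
        ∫ r, ∑ j, ∑ k, (step r (x j) - step r (y k)) ^ 2 := fun x y => by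
    rw [integral_finsetSum _ fun _ _ => integrable_finsetSum _ fun _ _ => integrable_step_sub_sq _ _]
    exact Finset.sum_congr rfl fun _ _ =>
      (integral_finsetSum _ fun _ _ => integrable_step_sub_sq _ _).symm
  rw [E, E, E, ← integral_add (I _ _) (I _ _), ← integral_const_mul]
  refine integral_mono ((I _ _).add (I _ _)) ((I _ _).const_mul 2) fun r => ?_
  have hstep : ∀ x, step r x ^ 2 = step r x := fun x => by simp [step]
  have hint : ∀ {m : ℕ} (x : Fin m → ℝ), ∃ P : ℤ, ∑ j, step r (x j) = P := fun x =>
    ⟨∑ j, if x j ≤ r then 1 else 0, by simp [step]⟩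
  obtain ⟨P, hP⟩ := hint t
  obtain ⟨Q, hQ⟩ := hint s
  simp only [sum_sum_sub_sq _ _ (fun i => hstep _) (fun i => hstep _), hP, hQ, Fintype.card_fin]
  -- The difference of the two sides at level r is 2 (P - Q) (P - Q - 1), a product of consecutive
  -- integers.
  have h : 0 ≤ (P - Q) * (P - Q - 1) := by
    rcases le_or_gt (P - Q) 0 with h | h
    · exact mul_nonneg_of_nonpos_of_nonpos h (by lia)
    · exact mul_nonneg h.le (by lia)
  have h' : (0 : ℝ) ≤ (P - Q) * (P - Q - 1) := by exact_mod_cast h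
  push_cast
  nlinarith

/-- Triangle inequality through each t_l, summed over l. For m = n + 1 the factor n / (n + 1) < 1 is
the slack that produces decay in s. -/
theorem card_mul_spread_le {n m : ℕ} (t : Fin m → ℝ) (s : Fin n → ℝ) :
    m * spread s ≤ 2 * n * ∑ j, ∑ k, |t j - s k| := by
  have h : ∀ l : Fin m, spread s ≤ 2 * n * ∑ k, |t l - s k| := fun l => by
    calc spread s ≤ ∑ j, ∑ k, (|t l - s j| + |t l - s k|) := by
          refine Finset.sum_le_sum fun j _ => Finset.sum_le_sum fun k _ => ?_
          rw [abs_sub_comm (t l) (s j)]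
          exact abs_sub_le _ _ _
      _ = 2 * n * ∑ k, |t l - s k| := by
          simp only [Finset.sum_add_distrib, Finset.sum_const, Finset.card_univ, Fintype.card_fin,
            nsmul_eq_mul, ← Finset.mul_sum]
          ring
  calc m * spread s = ∑ _l : Fin m, spread s := by simp
    _ ≤ _ := by rw [Finset.mul_sum]; exact Finset.sum_le_sum fun l _ => h l

/-! ### Integrable exponentials -/

theorem integrable_exp_neg_mul_abs {c : ℝ} (hc : 0 < c) :
    Integrable (fun r : ℝ => Real.exp (-c * |r|)) := by
  rw [← integrableOn_univ, ← Set.Iic_union_Ioi (a := (0 : ℝ))]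
  refine IntegrableOn.union ?_ ?_
  · refine (integrableOn_exp_mul_Iic hc 0).congr_fun (fun r hr => ?_) measurableSet_Iic
    simp [abs_of_nonpos (Set.mem_Iic.mp hr)]
  · refine (integrableOn_exp_mul_Ioi (neg_lt_zero.mpr hc) 0).congr_fun (fun r hr => ?_)
      measurableSet_Ioi
    simp [abs_of_pos (Set.mem_Ioi.mp hr)]

theorem integrable_exp_neg_mul_sum_abs {c : ℝ} (hc : 0 < c) (n : ℕ) :
    Integrable (fun s : Fin n → ℝ => Real.exp (-c * ∑ k, |s k|)) := by
  simp only [Finset.mul_sum, Real.exp_sum]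
  exact Integrable.fintype_prod (f := fun _ : Fin n => fun r : ℝ => Real.exp (-c * |r|))
    fun _ => integrable_exp_neg_mul_abs hc

/-! ### Holomorphy of integrals with parameters -/

/-- Cauchy's estimate for the Fréchet derivative. -/
theorem norm_fderiv_le_of_forall_mem_closedBall {E : Type*} [NormedAddCommGroup E]
    [NormedSpace ℂ E] {f : E → ℂ} {U : Set E} {z : E} {r b : ℝ} (hr : 0 < r)
    (hU : IsOpen U) (hzU : Metric.closedBall z r ⊆ U) (hf : DifferentiableOn ℂ f U)
    (hb : ∀ w ∈ Metric.closedBall z r, ‖f w‖ ≤ b) : ‖fderiv ℂ f z‖ ≤ b / r := by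
  have hz : z ∈ Metric.closedBall z r := Metric.mem_closedBall_self hr.le
  have hb0 : 0 ≤ b := (norm_nonneg _).trans (hb z hz)
  refine ContinuousLinearMap.opNorm_le_bound _ (by positivity) fun v => ?_
  rcases eq_or_ne v 0 with rfl | hv
  · simp
  have hv' : 0 < ‖v‖ := norm_pos_iff.mpr hv
  -- One-variable Cauchy estimate on the line z + c v; this radius keeps it in the ball.
  have hρ : 0 < r / ‖v‖ := by positivity
  have hmem : ∀ c ∈ Metric.closedBall (0 : ℂ) (r / ‖v‖), z + c • v ∈ Metric.closedBall z r := by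
    intro c hc
    rw [mem_closedBall_zero_iff, le_div_iff₀ hv'] at hc
    simpa [norm_smul] using hc
  have hline : ∀ c : ℂ, HasDerivAt (fun c : ℂ => z + c • v) v c := fun c => by
    simpa using ((hasDerivAt_id c).smul_const v).const_add z
  have hd : ∀ c ∈ Metric.closedBall (0 : ℂ) (r / ‖v‖),
      HasDerivAt (fun c : ℂ => f (z + c • v)) (fderiv ℂ f (z + c • v) v) c := fun c hc =>
    ((hf.differentiableAt (hU.mem_nhds (hzU (hmem c hc)))).hasFDerivAt).comp_hasDerivAt c (hline c)
  have h0 := hd 0 (Metric.mem_closedBall_self hρ.le)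
  have hdc : DiffContOnCl ℂ (fun c : ℂ => f (z + c • v)) (Metric.ball 0 (r / ‖v‖)) :=
    DifferentiableOn.diffContOnCl_ball (U := Metric.closedBall 0 (r / ‖v‖))
      (fun c hc => (hd c hc).differentiableAt.differentiableWithinAt) subset_rfl
  have := Complex.norm_deriv_le_of_forall_mem_sphere_norm_le hρ hdc fun c hc =>
    hb _ (hmem c (Metric.sphere_subset_closedBall hc))
  rw [h0.deriv, zero_smul, add_zero] at this
  calc _ ≤ _ := this
    _ = b / r * ‖v‖ := by field_simp

theorem aestronglyMeasurable_clm_of_apply {α E : Type*} [MeasurableSpace α] {μ : Measure α}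
    [NormedAddCommGroup E] [NormedSpace ℂ E] [FiniteDimensional ℂ E] {L : α → E →L[ℂ] ℂ}
    (h : ∀ v, AEStronglyMeasurable (fun a => L a v) μ) : AEStronglyMeasurable L μ := by
  let b := Module.finBasis ℂ E
  have hL : L = fun a => ∑ i, L a (b i) • LinearMap.toContinuousLinearMap (b.coord i) := by
    ext a v
    conv_lhs => rw [← b.sum_repr v, map_sum]
    simp [mul_comm]
  rw [hL]
  exact Finset.aestronglyMeasurable_fun_sum _ fun i _ => (h (b i)).smul_const _

/-- A locally dominated integral of holomorphic functions is holomorphic in the parameter. -/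
theorem differentiableOn_integral_of_locally_dominated {α E : Type*} [MeasurableSpace α]
    {μ : Measure α} [NormedAddCommGroup E] [NormedSpace ℂ E] [FiniteDimensional ℂ E]
    {U : Set E} (hU : IsOpen U) {f : E → α → ℂ}
    (hmeas : ∀ z, AEStronglyMeasurable (f z) μ)
    (hdiff : ∀ a, DifferentiableOn ℂ (fun z => f z a) U)
    (hdom : ∀ z ∈ U, ∃ V ∈ nhds z, ∃ b : α → ℝ, Integrable b μ ∧ ∀ w ∈ V, ∀ a, ‖f w a‖ ≤ b a) :
    DifferentiableOn ℂ (fun z => ∫ a, f z a ∂μ) U := by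
  intro z hz
  obtain ⟨V, hV, b, hb, hVb⟩ := hdom z hz
  obtain ⟨ε, hε, hball⟩ := Metric.mem_nhds_iff.mp (Filter.inter_mem hV (hU.mem_nhds hz))
  have hsub : ∀ w ∈ Metric.ball z (ε / 2), Metric.closedBall w (ε / 3) ⊆ V ∩ U := by
    intro w hw y hy
    refine hball ?_
    rw [Metric.mem_ball] at hw ⊢
    rw [Metric.mem_closedBall] at hy
    linarith [dist_triangle y w z]
  have hD : ∀ a, ∀ w ∈ U, HasFDerivAt (fun w => f w a) (fderiv ℂ (fun w => f w a) w) w :=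
    fun a w hw => ((hdiff a).differentiableAt (hU.mem_nhds hw)).hasFDerivAt
  have hself : ∀ w ∈ Metric.ball z (ε / 2), w ∈ V ∩ U := fun w hw =>
    hsub w hw (Metric.mem_closedBall_self (by positivity))
  have hzb : z ∈ Metric.ball z (ε / 2) := Metric.mem_ball_self (by positivity)
  refine (hasFDerivAt_integral_of_dominated_of_fderiv_le (𝕜 := ℂ) (F := f)
    (F' := fun w a => fderiv ℂ (fun w => f w a) w) (bound := fun a => b a / (ε / 3))
    (Metric.ball_mem_nhds z (half_pos hε)) ?_ ?_ ?_ ?_ ?_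
    ?_).differentiableAt.differentiableWithinAt
  · exact .of_forall hmeas
  · exact hb.mono' (hmeas z) (.of_forall fun a => hVb z (hself z hzb).1 a)
  · refine aestronglyMeasurable_clm_of_apply fun v => ?_
    -- The derivative is a pointwise limit of difference quotients, hence measurable in `a`.
    refine aestronglyMeasurable_of_tendsto_ae Filter.atTop
      (f := fun (n : ℕ) a => (n : ℂ) • (f (z + (n : ℂ)⁻¹ • v) a - f z a))
      (fun n => ((hmeas (z + (n : ℂ)⁻¹ • v)).sub (hmeas z)).const_smul (n : ℂ))
      (.of_forall fun a => (hD a z hz).lim v ?_)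
    simpa using tendsto_natCast_atTop_atTop (R := ℝ)
  · refine .of_forall fun a w hw => ?_
    exact norm_fderiv_le_of_forall_mem_closedBall (by positivity) hU
      (fun y hy => (hsub w hw hy).2) (hdiff a) fun y hy => hVb y (hsub w hw hy).1 a
  · exact hb.div_const _
  · exact .of_forall fun a w hw => hD a w (hself w hw).2

/-! ### Bounds for the weight, the kernel and the integrand -/

theorem sum_sum_Ioi_two_mul_abs {n : ℕ} (s : Fin n → ℝ) :
    ∑ j, ∑ k ∈ Finset.Ioi j, 2 * |s j - s k| = spread s := by
  have h := Finset.sum_sum_Ioi_add_eq_sum_sum_off_diag fun j k => |s j - s k|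
  have h1 : ∀ j k, |s k - s j| + |s j - s k| = 2 * |s j - s k| := fun j k => by
    rw [abs_sub_comm, two_mul]
  simp only [h1] at h
  rw [h, spread]
  refine Finset.sum_congr rfl fun j _ => ?_
  rw [← Finset.sum_compl_add_sum {j}]
  simp [abs_sub_comm]

theorem four_mul_sinh_sq_le (x : ℝ) : 4 * Real.sinh x ^ 2 ≤ Real.exp (2 * |x|) := by
  have h : 2 * |Real.sinh x| ≤ Real.exp |x| := by
    rw [Real.abs_sinh, Real.sinh_eq]
    linarith [Real.exp_pos (-|x|)]
  calc 4 * Real.sinh x ^ 2 = (2 * |Real.sinh x|) ^ 2 := by rw [mul_pow, sq_abs]; norm_num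
    _ ≤ Real.exp |x| ^ 2 := by gcongr
    _ = _ := by rw [← Real.exp_nat_mul]; norm_num

theorem norm_weight_le {n : ℕ} {lam : ℂ} (hlam : 0 < lam.re) (s : Fin n → ℝ) :
    ‖weight lam s‖ ≤ Real.exp (lam.re * spread s) := by
  rw [← sum_sum_Ioi_two_mul_abs, weight]
  simp only [norm_prod, Finset.mul_sum, Real.exp_sum]
  refine Finset.prod_le_prod (fun _ _ => by positivity) fun j _ =>
    Finset.prod_le_prod (fun _ _ => by positivity) fun k _ => ?_
  rw [Complex.norm_cpow_eq_rpow_re_of_nonneg (by positivity) hlam.ne', mul_comm lam.re,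
    Real.exp_mul]
  exact Real.rpow_le_rpow (by positivity) (four_mul_sinh_sq_le _) hlam.le

theorem exp_abs_le_two_mul_cosh (x : ℝ) : Real.exp |x| ≤ 2 * Real.cosh x := by
  rw [← Real.cosh_abs, Real.cosh_eq]
  linarith [Real.exp_pos (-|x|)]

theorem re_two_mul_cosh_sub (t : ℂ) (s : ℝ) :
    (2 * Complex.cosh (t - s)).re = 2 * Real.cosh (t.re - s) * Real.cos t.im := by
  have h : t - s = ((t.re - s : ℝ) : ℂ) + (t.im : ℂ) * Complex.I := by
    apply Complex.ext <;> simp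
  rw [h, Complex.cosh_add, Complex.cosh_mul_I, Complex.sinh_mul_I, ← Complex.ofReal_cosh,
    ← Complex.ofReal_sinh, ← Complex.ofReal_cos, ← Complex.ofReal_sin]
  simp only [Complex.add_re, Complex.mul_re, Complex.mul_im, Complex.ofReal_re, Complex.ofReal_im,
    Complex.I_re, Complex.I_im, Complex.re_ofNat, Complex.im_ofNat]
  ring

/-- The modulus is bounded below by the real part; the argument costs at most exp(π |Im λ|). -/
theorem norm_cosh_cpow_le {lam t : ℂ} {s γ : ℝ} (hlam : 0 ≤ lam.re) (hγ : 0 < γ)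
    (ht : γ ≤ Real.cos t.im) :
    ‖(2 * Complex.cosh (t - s)) ^ (-lam)‖ ≤
      γ ^ (-lam.re) * Real.exp (Real.pi * |lam.im|) * Real.exp (-lam.re * |t.re - s|) := by
  set z := 2 * Complex.cosh (t - s) with hz
  have hz1 : γ * Real.exp |t.re - s| ≤ ‖z‖ :=
    calc γ * Real.exp |t.re - s| ≤ Real.cos t.im * (2 * Real.cosh (t.re - s)) := by
          gcongr
          · exact hγ.le.trans ht
          · exact exp_abs_le_two_mul_cosh _
      _ = z.re := by rw [hz, re_two_mul_cosh_sub]; ring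
      _ ≤ ‖z‖ := Complex.re_le_norm z
  have harg : -(Complex.arg z * (-lam).im) ≤ Real.pi * |lam.im| := by
    calc -(Complex.arg z * (-lam).im) ≤ |Complex.arg z * lam.im| := by
          simpa only [Complex.neg_im, mul_neg, neg_neg] using le_abs_self _
      _ ≤ Real.pi * |lam.im| := by
          rw [abs_mul]; gcongr; exact Complex.abs_arg_le_pi z
  calc ‖z ^ (-lam)‖ ≤ ‖z‖ ^ (-lam).re / Real.exp (Complex.arg z * (-lam).im) :=
        Complex.norm_cpow_le _ _
    _ = ‖z‖ ^ (-lam.re) * Real.exp (-(Complex.arg z * (-lam).im)) := by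
        rw [Real.exp_neg, Complex.neg_re, div_eq_mul_inv]
    _ ≤ (γ * Real.exp |t.re - s|) ^ (-lam.re) * Real.exp (Real.pi * |lam.im|) := by
        gcongr ?_ * Real.exp ?_
        · exact Real.rpow_le_rpow_of_nonpos (by positivity) hz1 (by linarith)
    _ = _ := by
        rw [Real.mul_rpow hγ.le (Real.exp_pos _).le, ← Real.exp_mul, mul_comm |t.re - s|]; ring

/-- At real points the base is positive, so no factor depending on Im λ appears; this keeps the
constant in `exists_norm_F_le` uniform in λ. -/
theorem norm_cosh_cpow_ofReal_le {lam : ℂ} (hlam : 0 ≤ lam.re) (x s : ℝ) :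
    ‖(2 * Complex.cosh ((x : ℂ) - s)) ^ (-lam)‖ ≤ Real.exp (-lam.re * |x - s|) := by
  have h : 2 * Complex.cosh ((x : ℂ) - s) = ((2 * Real.cosh (x - s) : ℝ) : ℂ) := by simp
  have hpos : 0 < 2 * Real.cosh (x - s) := by positivity
  rw [h, Complex.norm_cpow_eq_rpow_re_of_pos hpos, mul_comm (-lam.re), Real.exp_mul,
    Complex.neg_re]
  exact Real.rpow_le_rpow_of_nonpos (Real.exp_pos _) (exp_abs_le_two_mul_cosh _) (by linarith)

theorem norm_kernelSharp_le {n : ℕ} {lam : ℂ} {t : Fin (n + 1) → ℂ} {s : Fin n → ℝ} {M : ℝ}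
    (hM : ∀ j k, ‖(2 * Complex.cosh (t j - (s k : ℂ))) ^ (-lam)‖ ≤
      M * Real.exp (-lam.re * |(t j).re - s k|)) :
    ‖kernelSharp lam t s‖ ≤
      M ^ (n * (n + 1)) * Real.exp (-lam.re * ∑ j, ∑ k, |(t j).re - s k|) := by
  rw [kernelSharp]
  simp only [norm_prod, Finset.mul_sum, Real.exp_sum]
  calc _ ≤ ∏ j : Fin (n + 1), ∏ k : Fin n, (M * Real.exp (-lam.re * |(t j).re - s k|)) :=
        Finset.prod_le_prod (fun _ _ => by positivity) fun j _ =>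
          Finset.prod_le_prod (fun _ _ => by positivity) fun k _ => hM j k
    _ = _ := by simp [Finset.prod_mul_distrib, pow_mul]

/-- The decay in `s` that is left after the growth of the weight is compensated. -/
theorem exponent_le {n : ℕ} {a θ : ℝ} (ha : 1 ≤ a) (hθ : 0 < θ) (hθ' : θ ≤ 1)
    (t : Fin (n + 1) → ℝ) (s : Fin n → ℝ) :
    a * spread s - a * ∑ j, ∑ k, |t j - s k| - a * (1 - θ / (2 * (n + 1))) / 2 * spread s ≤
      -(a * (1 - θ) / 2 * spread t) - θ / (2 * (n + 1)) * ∑ k, |s k - t 0| := by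
  have h1 := spread_add_spread_le t s
  have h2 := card_mul_spread_le t s
  have h3 : ∑ k, |s k - t 0| ≤ ∑ j, ∑ k, |t j - s k| := by
    simp only [abs_sub_comm _ (t 0)]
    exact Finset.single_le_sum (f := fun j => ∑ k, |t j - s k|)
      (fun _ _ => Finset.sum_nonneg fun _ _ => abs_nonneg _) (Finset.mem_univ 0)
  have h4 : 0 ≤ ∑ k, |s k - t 0| := Finset.sum_nonneg fun _ _ => abs_nonneg _
  generalize ∑ j, ∑ k, |t j - s k| = K at *
  generalize ∑ k, |s k - t 0| = k at *
  have hS := spread_nonneg s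
  generalize spread s = S at *
  generalize spread t = T at *
  have hn : (0 : ℝ) < n + 1 := by positivity
  have hK : 0 ≤ K := h4.trans h3
  set c := θ / (2 * ((n : ℝ) + 1)) with hc
  have hc0 : 0 < c := by positivity
  have hθc : θ = 2 * (n + 1) * c := by rw [hc]; field_simp
  push_cast at h2
  -- Split 1 + c = (1 - θ) + (θ + c): the first part yields the decay in t by `h1`, the second the
  -- decay in s by `h2`.
  have e1 : (1 - θ) * (S / 2 - K) ≤ -((1 - θ) * (T / 2)) := by nlinarith
  have e2 : (θ + c) * (S / 2) - θ * K ≤ -(c * K) := by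
    have : (θ + c) * ((n + 1) * S) ≤ (θ + c) * (2 * n * K) := by gcongr
    have h : (n + 1) * ((θ + c) * (S / 2) - θ * K) ≤ (n + 1) * (-(c * K)) := by
      have h' : (θ + c) * n * K - (n + 1) * θ * K + (n + 1) * c * K = -(c * K) := by
        linear_combination -K * hθc
      nlinarith [mul_nonneg hc0.le hK]
    exact le_of_mul_le_mul_left h hn
  have e3 : (1 + c) * S / 2 - K ≤ -((1 - θ) * (T / 2)) - c * k := by nlinarith
  have e4 : a * ((1 + c) * S / 2 - K) ≤ a * (-((1 - θ) * (T / 2)) - c * k) := by gcongr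
  have e5 : c * k ≤ a * (c * k) := le_mul_of_one_le_left (by positivity) ha
  nlinarith

theorem norm_integrand_le {n : ℕ} {lam : ℂ} {C M θ : ℝ} (hlam : 1 ≤ lam.re)
    (hθ : 0 < θ) (hθ' : θ ≤ 1) {u : Fin (n + 1) → ℝ} {t : Fin (n + 1) → ℂ} {s : Fin n → ℝ}
    (hC : ∀ u : Fin n → ℝ, ‖F n lam (fun k => (s k : ℂ)) u‖ ≤
      C * Real.exp (-(lam.re * (1 - θ / (2 * (n + 1))) / 2 * spread s)))
    (hM : ∀ j k, ‖(2 * Complex.cosh (t j - (s k : ℂ))) ^ (-lam)‖ ≤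
      M * Real.exp (-lam.re * |(t j).re - s k|)) :
    ‖integrand n lam t u s‖ ≤ C * M ^ (n * (n + 1)) *
      Real.exp (-(lam.re * (1 - θ) / 2 * spread fun j => (t j).re)) *
        Real.exp (-(θ / (2 * (n + 1))) * ∑ k, |s k - (t 0).re|) := by
  have hK := norm_kernelSharp_le hM
  have hF := hC fun k => u k.castSucc - u (Fin.last n)
  have hW := norm_weight_le (by linarith : 0 < lam.re) s
  have hM0 : 0 ≤ M ^ (n * (n + 1)) :=
    nonneg_of_mul_nonneg_left ((norm_nonneg _).trans hK) (Real.exp_pos _)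
  have hC0 : 0 ≤ C := nonneg_of_mul_nonneg_left ((norm_nonneg _).trans hF) (Real.exp_pos _)
  rw [integrand, stepIntegrand, norm_mul, norm_mul]
  calc _ ≤ Real.exp (lam.re * spread s) *
        (M ^ (n * (n + 1)) * Real.exp (-lam.re * ∑ j, ∑ k, |(t j).re - s k|)) *
        (C * Real.exp (-(lam.re * (1 - θ / (2 * (n + 1))) / 2 * spread s))) := by
        gcongr
    _ = C * M ^ (n * (n + 1)) * Real.exp (lam.re * spread s -
          lam.re * ∑ j, ∑ k, |(t j).re - s k| -
            lam.re * (1 - θ / (2 * (n + 1))) / 2 * spread s) := by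
        rw [Real.exp_sub, Real.exp_sub, neg_mul, Real.exp_neg, Real.exp_neg]; ring
    _ ≤ C * M ^ (n * (n + 1)) * Real.exp (-(lam.re * (1 - θ) / 2 * spread fun j => (t j).re) -
          θ / (2 * (n + 1)) * ∑ k, |s k - (t 0).re|) := by
        gcongr _ * Real.exp ?_
        exact exponent_le hlam hθ hθ' (fun j => (t j).re) s
    _ = _ := by rw [sub_eq_add_neg, Real.exp_add, neg_mul]; ring

/-! ### Recursion and measurability -/

/-- The recursion that defines `F`, including its first step. -/
theorem F_succ (n : ℕ) (lam : ℂ) (t : Fin (n + 1) → ℂ) (u : Fin (n + 1) → ℝ) :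
    F (n + 1) lam t u =
      Complex.exp (Complex.I * (u (Fin.last n) : ℂ) * ∑ j, t j) / (n.factorial : ℂ) *
        ∫ s : Fin n → ℝ, integrand n lam t u s := by
  cases n with
  -- ℝ^0 is a point of mass 1 and `F 0` is 1, so the recursion also yields F_1.
  | zero =>
    simp [F, integrand, stepIntegrand, weight, kernelSharp, integral_unique, mul_right_comm, Measure.real,
      volume_pi]
  | succ n => rfl

theorem measurable_weight (n : ℕ) (lam : ℂ) : Measurable fun s : Fin n → ℝ => weight lam s := by
  unfold weight
  fun_prop

theorem measurable_kernelSharp (n : ℕ) (lam : ℂ) :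
    Measurable fun p : (Fin (n + 1) → ℂ) × (Fin n → ℝ) => kernelSharp lam p.1 p.2 := by
  unfold kernelSharp
  fun_prop

theorem measurable_F (n : ℕ) (lam : ℂ) (u : Fin n → ℝ) : Measurable fun t => F n lam t u := by
  induction n with
  | zero => exact measurable_const
  | succ n ih =>
    simp only [F_succ]
    have h : Measurable fun p : (Fin (n + 1) → ℂ) × (Fin n → ℝ) => integrand n lam p.1 u p.2 := by
      unfold integrand stepIntegrand
      refine (((measurable_weight n lam).comp measurable_snd).mul
        (measurable_kernelSharp n lam)).mul ?_
      exact (ih _).comp (by fun_prop)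
    exact Measurable.mul (by fun_prop) h.stronglyMeasurable.integral_prod_right'.measurable

theorem measurable_integrand (n : ℕ) (lam : ℂ) (t : Fin (n + 1) → ℂ) (u : Fin (n + 1) → ℝ) :
    Measurable fun s => integrand n lam t u s := by
  unfold integrand stepIntegrand
  refine ((measurable_weight n lam).mul
    ((measurable_kernelSharp n lam).comp (measurable_const.prodMk measurable_id))).mul ?_
  exact (measurable_F n lam _).comp (by fun_prop)

/-! ### Decay at real points and domination of the integrand -/

/-- The exponential decay of `F` at real points, uniform in the half plane `Re λ ≥ 1`. -/
theorem exists_norm_F_le (n : ℕ) : ∀ θ : ℝ, 0 < θ → θ ≤ 1 → ∃ C : ℝ, ∀ lam : ℂ, 1 ≤ lam.re →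
    ∀ x u : Fin n → ℝ, ‖F n lam (fun k => (x k : ℂ)) u‖ ≤
      C * Real.exp (-(lam.re * (1 - θ) / 2 * spread x)) := by
  induction n with
  | zero => exact fun θ _ _ => ⟨1, fun lam _ x u => by simp [F, spread]⟩
  | succ n ih =>
    intro θ hθ hθ'
    have hη : θ / (2 * (n + 1)) ≤ 1 := by
      rw [div_le_one (by positivity)]; linarith [(Nat.cast_nonneg n : (0 : ℝ) ≤ n)]
    -- The loss at level n is taken smaller than θ; the difference pays for integrability in s.
    obtain ⟨C, hC⟩ := ih (θ / (2 * (n + 1))) (by positivity) hη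
    refine ⟨C * ∫ s : Fin n → ℝ, Real.exp (-(θ / (2 * (n + 1))) * ∑ k, |s k|),
      fun lam hlam x u => ?_⟩
    have hexp : ‖Complex.exp (Complex.I * (u (Fin.last n) : ℂ) * ∑ j, (x j : ℂ))‖ = 1 := by
      rw [mul_assoc, ← Complex.ofReal_sum, ← Complex.ofReal_mul, Complex.norm_exp_I_mul_ofReal]
    have hfac : (1 : ℝ) ≤ n.factorial := by exact_mod_cast n.factorial_pos
    have hint := integrable_exp_neg_mul_sum_abs (c := θ / (2 * (n + 1))) (by positivity) n
    rw [F_succ, norm_mul, norm_div, hexp, Complex.norm_natCast]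
    calc 1 / (n.factorial : ℝ) * ‖∫ s : Fin n → ℝ, integrand n lam (fun k => (x k : ℂ)) u s‖
        ≤ 1 * ‖∫ s : Fin n → ℝ, integrand n lam (fun k => (x k : ℂ)) u s‖ := by
          gcongr
          rw [div_le_one (by positivity)]
          exact hfac
      _ ≤ ∫ s : Fin n → ℝ, C * Real.exp (-(lam.re * (1 - θ) / 2 * spread x)) *
            Real.exp (-(θ / (2 * (n + 1))) * ∑ k, |s k - x 0|) := by
          rw [one_mul]
          refine norm_integral_le_of_norm_le ((hint.comp_sub_right fun _ => x 0).const_mul _)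
            (.of_forall fun s => ?_)
          have := norm_integrand_le (M := 1) (t := fun k => (x k : ℂ)) (u := u) hlam hθ hθ'
            (hC lam hlam s) fun j k => by
              simpa using norm_cosh_cpow_ofReal_le (by linarith) (x j) (s k)
          simpa using this
      _ = _ := by
          have h := integral_sub_right_eq_self (μ := volume)
            (fun s : Fin n → ℝ => Real.exp (-(θ / (2 * (n + 1))) * ∑ k, |s k|)) fun _ => x 0
          simp only [Pi.sub_apply] at h
          rw [integral_const_mul, h]
          ring

theorem isOpen_Lam (κ : ℝ) : IsOpen (Lam κ) := isOpen_lt continuous_const Complex.continuous_re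

theorem isOpen_polystrip (n : ℕ) : IsOpen (polystrip n) := by
  simp only [polystrip, Set.ofPred_forall]
  exact isOpen_iInter_of_finite fun j => isOpen_lt (by fun_prop) continuous_const

theorem isOpen_domA (n : ℕ) : IsOpen (domA n) := by
  simp only [domA, Set.ofPred_forall]
  exact isOpen_iInter_of_finite fun j => isOpen_iInter_of_finite fun k =>
    isOpen_iInter_of_finite fun _ => isOpen_lt (by fun_prop) continuous_const

theorem cos_im_pos {n : ℕ} {t : Fin n → ℂ} (ht : t ∈ polystrip n) (j : Fin n) :
    0 < Real.cos (t j).im :=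
  Real.cos_pos_of_mem_Ioo (abs_lt.mp (ht j))

/-- A common integrable bound of the integrands for bounded `λ` and `t` inside the polystrip. -/
theorem exists_integrable_bound (n : ℕ) {γ : ℝ} (hγ : 0 < γ) (R B x : ℝ) :
    ∃ b : (Fin n → ℝ) → ℝ, Integrable b ∧ ∀ lam : ℂ, 1 ≤ lam.re → lam.re ≤ R → |lam.im| ≤ B →
      ∀ t : Fin (n + 1) → ℂ, (∀ j, γ ≤ Real.cos (t j).im) → |(t 0).re - x| ≤ 1 →
        ∀ u s, ‖integrand n lam t u s‖ ≤ b s := by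
  -- The case θ = 1: all decay in t is given up.
  set c : ℝ := 1 / (2 * (n + 1)) with hc
  have hc0 : 0 < c := by positivity
  have hc1 : c ≤ 1 := by
    rw [hc, div_le_one (by positivity)]; linarith [(Nat.cast_nonneg n : (0 : ℝ) ≤ n)]
  obtain ⟨C, hC⟩ := exists_norm_F_le n c hc0 hc1
  set M : ℝ := γ ^ (-R) * Real.exp (Real.pi * B) with hM
  have hM0 : 0 ≤ M := by positivity
  -- The factor exp(c n) pays for moving the centre from Re t_0 to x, at most 1 in each of n terms.
  refine ⟨fun s => C * M ^ (n * (n + 1)) * Real.exp (c * n) * Real.exp (-c * ∑ k, |s k - x|),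
    ((integrable_exp_neg_mul_sum_abs hc0 n).comp_sub_right fun _ => x).const_mul _, ?_⟩
  intro lam h1 hR hB t ht hx u s
  have hC0 : 0 ≤ C := nonneg_of_mul_nonneg_left ((norm_nonneg _).trans (hC lam h1 0 0))
    (Real.exp_pos _)
  have hγ1 : γ ≤ 1 := (ht 0).trans (Real.cos_le_one _)
  have h := norm_integrand_le (M := M) (θ := 1) (u := u) (t := t) h1 one_pos le_rfl
    (hC lam h1 s) fun j k => (norm_cosh_cpow_le (by linarith) hγ (ht j)).trans (by
      rw [hM]
      gcongr ?_ * Real.exp (_ * ?_) * _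
      exact Real.rpow_le_rpow_of_exponent_ge hγ hγ1 (by linarith))
  rw [sub_self, mul_zero, zero_div, zero_mul, neg_zero, Real.exp_zero, mul_one] at h
  refine h.trans ?_
  beta_reduce
  rw [mul_assoc _ (Real.exp (c * n)), ← Real.exp_add, ← hc]
  gcongr _ * Real.exp ?_
  have hsum : ∑ k, |s k - x| ≤ ∑ k, |s k - (t 0).re| + n :=
    calc ∑ k, |s k - x| ≤ ∑ k, (|s k - (t 0).re| + 1) := by
          refine Finset.sum_le_sum fun k _ => (abs_sub_le _ (t 0).re _).trans ?_
          gcongr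
      _ = _ := by simp [Finset.sum_add_distrib]
  nlinarith

theorem exists_pos_le_cos_im {n : ℕ} {t : Fin (n + 1) → ℂ} (ht : t ∈ polystrip (n + 1)) :
    ∃ γ : ℝ, 0 < γ ∧ ∀ j, γ < Real.cos (t j).im := by
  obtain ⟨j, hj⟩ := Finite.exists_min fun j => Real.cos (t j).im
  have := cos_im_pos ht j
  -- Half the minimum makes the inequality strict, hence an open condition on t.
  exact ⟨Real.cos (t j).im / 2, by positivity, fun k => by linarith [hj k]⟩

theorem integrable_integrand {n : ℕ} {lam : ℂ} (hlam : 1 ≤ lam.re) {t : Fin (n + 1) → ℂ}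
    (ht : t ∈ polystrip (n + 1)) (u : Fin (n + 1) → ℝ) :
    Integrable fun s : Fin n → ℝ => integrand n lam t u s := by
  obtain ⟨γ, hγ, hγt⟩ := exists_pos_le_cos_im ht
  obtain ⟨b, hb, hle⟩ := exists_integrable_bound n hγ lam.re |lam.im| (t 0).re
  exact hb.mono' (measurable_integrand n lam t u).aestronglyMeasurable
    (.of_forall (hle lam hlam le_rfl le_rfl t (fun j => (hγt j).le) (by simp) u))

/-! ### Holomorphy on the polystrip -/

theorem differentiableOn_kernelSharp (n : ℕ) (s : Fin n → ℝ) :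
    DifferentiableOn ℂ (fun p : ℂ × (Fin (n + 1) → ℂ) => kernelSharp p.1 p.2 s)
      (Lam 1 ×ˢ polystrip (n + 1)) := by
  intro p hp
  unfold kernelSharp
  refine DifferentiableAt.differentiableWithinAt ?_
  refine (HasFDerivAt.finsetProd fun j _ => DifferentiableAt.hasFDerivAt ?_).differentiableAt
  refine (HasFDerivAt.finsetProd fun k _ => DifferentiableAt.hasFDerivAt ?_).differentiableAt
  refine DifferentiableAt.cpow (by fun_prop) (by fun_prop) (Or.inl ?_)
  rw [re_two_mul_cosh_sub]
  have := cos_im_pos hp.2 j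
  positivity

theorem differentiableOn_weight (n : ℕ) (s : Fin n → ℝ) :
    DifferentiableOn ℂ (fun lam => weight lam s) (Lam 1) := by
  intro lam hlam
  unfold weight
  -- The base vanishes where two s_j coincide, and 0 ^ λ is holomorphic only off λ = 0.
  have h0 : lam ≠ 0 := by
    rintro rfl
    simp [Lam] at hlam
    linarith
  exact DifferentiableAt.differentiableWithinAt <|
    DifferentiableAt.fun_finsetProd fun j _ => DifferentiableAt.fun_finsetProd fun k _ =>
      DifferentiableAt.const_cpow differentiableAt_fun_id (Or.inr h0)

theorem ofReal_mem_polystrip {n : ℕ} (x : Fin n → ℝ) : (fun k => (x k : ℂ)) ∈ polystrip n :=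
  fun j => by simpa using Real.pi_div_two_pos

/-- `F` is holomorphic in `(λ, t)` where its integral converges. -/
theorem differentiableOn_F (n : ℕ) (u : Fin n → ℝ) :
    DifferentiableOn ℂ (fun p : ℂ × (Fin n → ℂ) => F n p.1 p.2 u) (Lam 1 ×ˢ polystrip n) := by
  induction n with
  | zero => exact differentiableOn_const _
  | succ n ih =>
    simp only [F_succ]
    refine DifferentiableOn.mul (by fun_prop) ?_
    refine differentiableOn_integral_of_locally_dominated
      ((isOpen_Lam 1).prod (isOpen_polystrip (n + 1)))
      (f := fun (p : ℂ × (Fin (n + 1) → ℂ)) s => integrand n p.1 p.2 u s)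
      (fun p => (measurable_integrand n p.1 p.2 u).aestronglyMeasurable) (fun s => ?_) ?_
    · unfold integrand stepIntegrand
      refine (((differentiableOn_weight n s).comp differentiableOn_fst fun p hp => hp.1).mul
        (differentiableOn_kernelSharp n s)).mul ?_
      exact (ih _).comp (f := fun p : ℂ × (Fin (n + 1) → ℂ) => (p.1, fun k => (s k : ℂ)))
        (by fun_prop) fun p hp => ⟨hp.1, ofReal_mem_polystrip s⟩
    · rintro ⟨lam, t⟩ ⟨hlam, ht⟩
      obtain ⟨γ, hγ, hγt⟩ := exists_pos_le_cos_im ht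
      obtain ⟨b, hb, hle⟩ :=
        exists_integrable_bound n hγ (lam.re + 1) (|lam.im| + 1) (t 0).re
      refine ⟨{p | 1 < p.1.re} ∩ {p | p.1.re < lam.re + 1} ∩ {p | |p.1.im| < |lam.im| + 1} ∩
        {p | ∀ j, γ < Real.cos (p.2 j).im} ∩ {p | |(p.2 0).re - (t 0).re| < 1},
        IsOpen.mem_nhds ?_ ?_, b, hb, ?_⟩
      · simp only [Set.ofPred_forall]
        refine IsOpen.inter (IsOpen.inter (IsOpen.inter (IsOpen.inter ?_ ?_) ?_) ?_) ?_
        · exact isOpen_lt (by fun_prop) (by fun_prop)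
        · exact isOpen_lt (by fun_prop) (by fun_prop)
        · exact isOpen_lt (by fun_prop) (by fun_prop)
        · exact isOpen_iInter_of_finite fun j => isOpen_lt (by fun_prop) (by fun_prop)
        · exact isOpen_lt (by fun_prop) (by fun_prop)
      · exact ⟨⟨⟨⟨hlam, by simp⟩, by simp⟩, hγt⟩, by simp⟩
      · rintro ⟨lam', t'⟩ ⟨⟨⟨⟨h1, h2⟩, h3⟩, h4⟩, h5⟩ s
        exact hle lam' h1.le h2.le h3.le t' (fun j => (h4 j).le) h5.le u s

/-! ### Translations and continuation to 𝒜_N -/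

/-- Substitute s + y for s: weight and kernel depend on differences only. The phases ∑ (u_k - u_N)
and N u_N add up to ∑ u_j. -/
theorem F_add_ofReal (n : ℕ) (lam : ℂ) (t : Fin n → ℂ) (u : Fin n → ℝ) (y : ℝ) :
    F n lam (fun j => t j + y) u =
      Complex.exp (Complex.I * y * ∑ j, (u j : ℂ)) * F n lam t u := by
  induction n with
  | zero => simp [F]
  | succ n ih =>
    have hstep : ∀ s : Fin n → ℝ,
        integrand n lam (fun j => t j + y) u (s + fun _ => y) =
          Complex.exp (Complex.I * y * ∑ k : Fin n, (u k.castSucc - u (Fin.last n) : ℂ)) *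
            integrand n lam t u s := by
      intro s
      have hF := ih (fun k => (s k : ℂ)) fun k => u k.castSucc - u (Fin.last n)
      simp only [integrand, stepIntegrand, weight, kernelSharp, Pi.add_apply,
        add_sub_add_right_eq_sub, Complex.ofReal_add, hF, Complex.ofReal_sub]
      ring
    rw [F_succ, F_succ, ← integral_add_right_eq_self _ fun _ => y]
    simp only [hstep, integral_const_mul]
    rw [Fin.sum_univ_castSucc (fun j => (u j : ℂ))]
    simp only [Finset.sum_add_distrib, Finset.sum_sub_distrib, Finset.sum_const, Finset.card_univ,
      Fintype.card_fin, nsmul_eq_mul]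
    rw [div_mul_eq_mul_div, div_mul_eq_mul_div, mul_div_assoc', ← mul_assoc, ← mul_assoc,
      ← Complex.exp_add, ← Complex.exp_add]
    congr 3
    push_cast
    ring

/-- `F` at `t - z`, multiplied by the factor that makes it independent of `z`. -/
def shiftedF {n : ℕ} (u : Fin n → ℝ) (z lam : ℂ) (t : Fin n → ℂ) : ℂ :=
  Complex.exp (Complex.I * z * ∑ j, (u j : ℂ)) * F n lam (fun j => t j - z) u

theorem differentiableAt_shiftedF {n : ℕ} (u : Fin n → ℝ) {z lam : ℂ} {t : Fin n → ℂ}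
    (hlam : lam ∈ Lam 1) (ht : (fun j => t j - z) ∈ polystrip n) :
    DifferentiableAt ℂ (fun p : ℂ × ℂ × (Fin n → ℂ) => shiftedF u p.1 p.2.1 p.2.2)
      (z, lam, t) := by
  unfold shiftedF
  refine DifferentiableAt.mul (by fun_prop) ?_
  have h : DifferentiableAt ℂ (fun p : ℂ × (Fin n → ℂ) => F n p.1 p.2 u)
      (lam, fun j => t j - z) :=
    (differentiableOn_F n u).differentiableAt
      (((isOpen_Lam 1).prod (isOpen_polystrip n)).mem_nhds ⟨hlam, ht⟩)
  exact DifferentiableAt.comp (z, lam, t)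
    (f := fun p : ℂ × ℂ × (Fin n → ℂ) => (p.2.1, fun j => p.2.2 j - p.1)) h (by fun_prop)

theorem shiftedF_add_ofReal {n : ℕ} (u : Fin n → ℝ) (z lam : ℂ) (t : Fin n → ℂ) (y : ℝ) :
    shiftedF u (z + y) lam t = shiftedF u z lam t := by
  have h := F_add_ofReal n lam (fun j => t j - (z + y)) u y
  simp only [sub_add, add_sub_cancel_right] at h
  rw [shiftedF, shiftedF, h, ← mul_assoc, ← Complex.exp_add]
  congr 3
  ring

/-- The admissible z form a convex open set. Invariance under real shifts makes the complex
derivative in z vanish. -/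
theorem shiftedF_eq_shiftedF {n : ℕ} (u : Fin n → ℝ) {z z' lam : ℂ} {t : Fin n → ℂ}
    (hlam : lam ∈ Lam 1) (hz : (fun j => t j - z) ∈ polystrip n)
    (hz' : (fun j => t j - z') ∈ polystrip n) :
    shiftedF u z lam t = shiftedF u z' lam t := by
  set U : Set ℂ := {z | (fun j => t j - z) ∈ polystrip n} with hU
  have hUo : IsOpen U := (isOpen_polystrip n).preimage (by fun_prop)
  have hUc : Convex ℝ U := by
    have : U = ⋂ j, Complex.im ⁻¹' Metric.ball (t j).im (Real.pi / 2) := by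
      ext z
      simp [hU, polystrip, Real.dist_eq, abs_sub_comm]
    rw [this]
    exact convex_iInter fun j => (convex_ball _ _).is_linear_preimage Complex.imLm.isLinear
  have hd : ∀ z ∈ U, DifferentiableAt ℂ (fun z => shiftedF u z lam t) z := fun z hz =>
    DifferentiableAt.comp z (f := fun z : ℂ => (z, lam, t)) (differentiableAt_shiftedF u hlam hz)
      (by fun_prop)
  refine hUo.is_const_of_deriv_eq_zero hUc.isPreconnected
    (f := fun z => shiftedF u z lam t) (fun z hz => (hd z hz).differentiableWithinAt)
    (fun z hz => ?_) hz hz'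
  have hline : HasDerivAt (fun y : ℝ => z + (y : ℂ)) 1 0 :=
    Complex.ofRealCLM.hasDerivAt.const_add z
  have h0 : HasDerivAt (fun z => shiftedF u z lam t) (deriv (fun z => shiftedF u z lam t) z)
      (z + ((0 : ℝ) : ℂ)) := by simpa using (hd z hz).hasDerivAt
  have h1 := h0.comp (0 : ℝ) hline
  have h2 : HasDerivAt (fun _ : ℝ => shiftedF u z lam t) 0 0 := hasDerivAt_const _ _
  have h3 : ((fun z => shiftedF u z lam t) ∘ fun y : ℝ => z + (y : ℂ)) =
      fun _ => shiftedF u z lam t := funext fun y => shiftedF_add_ofReal u z lam t y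
  rw [h3] at h1
  simpa using h1.unique h2

theorem exists_sub_mem_polystrip {n : ℕ} {t : Fin (n + 1) → ℂ} (ht : t ∈ domA (n + 1)) :
    ∃ z : ℂ, (fun j => t j - z) ∈ polystrip (n + 1) := by
  obtain ⟨a, ha⟩ := Finite.exists_max fun j => (t j).im
  obtain ⟨b, hb⟩ := Finite.exists_min fun j => (t j).im
  have hab : (t a).im - (t b).im < Real.pi := by
    rcases lt_trichotomy a b with h | h | h
    · simpa using (abs_lt.mp (ht a b h)).2
    · simpa [h] using Real.pi_pos
    · have := (abs_lt.mp (ht b a h)).1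
      simp only [Complex.sub_im] at this
      linarith
  -- The midpoint of the extreme imaginary parts, which differ by less than π.
  refine ⟨(((t a).im + (t b).im) / 2 : ℝ) * Complex.I, fun j => ?_⟩
  have h1 := ha j
  have h2 := hb j
  simp only [Complex.sub_im, Complex.im_ofReal_mul, Complex.I_im, mul_one]
  rw [abs_lt]
  constructor <;> linarith

/-- The continuation of `F` to `𝒜_N`. -/
def extF {n : ℕ} (u : Fin n → ℝ) (lam : ℂ) (t : Fin n → ℂ) : ℂ :=
  shiftedF u (Classical.epsilon fun z => (fun j => t j - z) ∈ polystrip n) lam t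

theorem extF_eq_shiftedF {n : ℕ} (u : Fin n → ℝ) {z lam : ℂ} {t : Fin n → ℂ}
    (hlam : lam ∈ Lam 1) (hz : (fun j => t j - z) ∈ polystrip n) :
    extF u lam t = shiftedF u z lam t :=
  shiftedF_eq_shiftedF u hlam
    (Classical.epsilon_spec (p := fun z => (fun j => t j - z) ∈ polystrip n) ⟨z, hz⟩) hz

theorem extF_eq_F {n : ℕ} (u : Fin n → ℝ) {lam : ℂ} {t : Fin n → ℂ}
    (hlam : lam ∈ Lam 1) (ht : t ∈ polystrip n) : extF u lam t = F n lam t u := by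
  rw [extF_eq_shiftedF u (z := 0) hlam (by simpa using ht)]
  simp [shiftedF]

theorem differentiableOn_extF {n : ℕ} (u : Fin (n + 1) → ℝ) :
    DifferentiableOn ℂ (fun p : ℂ × (Fin (n + 1) → ℂ) => extF u p.1 p.2)
      (Lam 1 ×ˢ domA (n + 1)) := by
  rintro ⟨lam, t⟩ ⟨hlam, ht⟩
  obtain ⟨z, hz⟩ := exists_sub_mem_polystrip ht
  have hd : DifferentiableAt ℂ (fun p : ℂ × (Fin (n + 1) → ℂ) => shiftedF u z p.1 p.2) (lam, t) :=
    DifferentiableAt.comp (lam, t) (f := fun p : ℂ × (Fin (n + 1) → ℂ) => (z, p.1, p.2))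
      (differentiableAt_shiftedF u hlam hz) (by fun_prop)
  -- A shift z admissible for t stays admissible near t, so it can be held fixed.
  refine (hd.congr_of_eventuallyEq ?_).differentiableWithinAt
  have hV : IsOpen {p : ℂ × (Fin (n + 1) → ℂ) |
      p.1 ∈ Lam 1 ∧ (fun j => p.2 j - z) ∈ polystrip (n + 1)} :=
    ((isOpen_Lam 1).preimage continuous_fst).inter ((isOpen_polystrip _).preimage (by fun_prop))
  exact Filter.eventually_of_mem (hV.mem_nhds ⟨hlam, hz⟩) fun p hp => extF_eq_shiftedF u hp.1 hp.2

/-! ### Uniqueness of the continuation -/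

theorem convex_domA (n : ℕ) : Convex ℝ (domA n) := by
  simp only [domA, Set.ofPred_forall]
  refine convex_iInter fun j => convex_iInter fun k => convex_iInter fun _ => ?_
  have : {t : Fin n → ℂ | |(t j - t k).im| < Real.pi} =
      (fun t : Fin n → ℂ => (t j - t k).im) ⁻¹' Metric.ball 0 Real.pi := by
    ext t
    simp
  rw [this]
  exact (convex_ball _ _).is_linear_preimage
    ⟨fun x y => by simp only [Pi.add_apply, Complex.sub_im, Complex.add_im]; ring,
      fun a x => by simp [mul_sub]⟩

/-- A holomorphic function on a convex open subset of `ℂ^N` that contains `ℝ^N` is determined by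
its values on `ℝ^N`. -/
theorem eqOn_of_eq_ofReal {n : ℕ} {U : Set (Fin n → ℂ)} (hUo : IsOpen U) (hUc : Convex ℝ U)
    (hU : ∀ x : Fin n → ℝ, (fun j => (x j : ℂ)) ∈ U) {f g : (Fin n → ℂ) → ℂ}
    (hf : DifferentiableOn ℂ f U) (hg : DifferentiableOn ℂ g U)
    (hfg : ∀ x : Fin n → ℝ, f (fun j => (x j : ℂ)) = g fun j => (x j : ℂ)) : Set.EqOn f g U := by
  intro t ht
  -- This line is real for real z and passes through t at z = i.
  let ℓ : ℂ → Fin n → ℂ := fun z j => (t j).re + z * (t j).im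
  have hℓ : Differentiable ℂ ℓ := by fun_prop
  have hreal : ∀ y : ℝ, ℓ y = fun j => (((t j).re + y * (t j).im : ℝ) : ℂ) := fun y => by
    ext j; simp [ℓ]
  set V : Set ℂ := ℓ ⁻¹' U
  have hVo : IsOpen V := hUo.preimage hℓ.continuous
  have hVc : Convex ℝ V := by
    intro z hz w hw a b ha hb hab
    have h := hUc hz hw ha hb hab
    have e : a • ℓ z + b • ℓ w = ℓ (a • z + b • w) := by
      ext j
      have hab' : (a : ℂ) + b = 1 := by exact_mod_cast hab
      simp only [ℓ, Pi.add_apply, Pi.smul_apply, Complex.real_smul]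
      linear_combination ((t j).re : ℂ) * hab'
    rwa [e] at h
  have h0 : (0 : ℂ) ∈ V := by
    have := hU fun j => (t j).re + (0 : ℝ) * (t j).im
    rw [← hreal 0] at this
    simpa [V] using this
  have hI : ℓ Complex.I = t := by
    ext j
    simp only [ℓ, mul_comm Complex.I, Complex.re_add_im]
  have hIV : Complex.I ∈ V := by simpa [V, hI] using ht
  have hfV : AnalyticOnNhd ℂ (f ∘ ℓ) V :=
    (hf.comp hℓ.differentiableOn fun z hz => hz).analyticOnNhd hVo
  have hgV : AnalyticOnNhd ℂ (g ∘ ℓ) V :=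
    (hg.comp hℓ.differentiableOn fun z hz => hz).analyticOnNhd hVo
  have hfreq : ∃ᶠ z in nhdsWithin (0 : ℂ) {0}ᶜ, (f ∘ ℓ) z = (g ∘ ℓ) z := by
    have ht : Filter.Tendsto (fun y : ℝ => (y : ℂ)) (nhdsWithin 0 {0}ᶜ) (nhdsWithin 0 {0}ᶜ) := by
      refine tendsto_nhdsWithin_iff.mpr ⟨?_, ?_⟩
      · exact (Complex.continuous_ofReal.tendsto' 0 0 (by simp)).mono_left nhdsWithin_le_nhds
      · filter_upwards [self_mem_nhdsWithin] with y hy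
        simpa using hy
    refine ht.frequently (Filter.Eventually.frequently (.of_forall fun y => ?_))
    simp only [Function.comp_apply, hreal]
    exact hfg _
  have := hfV.eqOn_of_preconnected_of_frequently_eq hgV hVc.isPreconnected h0 hfreq hIV
  simpa [hI] using this

end

end HypCM

theorem theorem6p1 (n : ℕ) (u : Fin (n + 1) → ℝ) :
    (∀ lam : ℂ, 1 ≤ lam.re → ∀ t ∈ HypCM.polystrip (n + 1),
      MeasureTheory.Integrable (fun s : Fin n → ℝ => HypCM.integrand n lam t u s)) ∧
    ∃ G : ℂ × (Fin (n + 1) → ℂ) → ℂ,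
      DifferentiableOn ℂ G (HypCM.Lam 1 ×ˢ HypCM.domA (n + 1)) ∧
      (∀ lam ∈ HypCM.Lam 1, ∀ t ∈ HypCM.polystrip (n + 1),
        G (lam, t) = HypCM.F (n + 1) lam t u) ∧
      ∀ G' : ℂ × (Fin (n + 1) → ℂ) → ℂ,
        DifferentiableOn ℂ G' (HypCM.Lam 1 ×ˢ HypCM.domA (n + 1)) →
        (∀ lam ∈ HypCM.Lam 1, ∀ x : Fin (n + 1) → ℝ,
          G' (lam, fun j => (x j : ℂ)) = HypCM.F (n + 1) lam (fun j => (x j : ℂ)) u) →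
        Set.EqOn G' G (HypCM.Lam 1 ×ˢ HypCM.domA (n + 1)) := by
  refine ⟨fun lam hlam t ht => HypCM.integrable_integrand hlam ht u,
    fun p => HypCM.extF u p.1 p.2, HypCM.differentiableOn_extF u,
    fun lam hlam t ht => HypCM.extF_eq_F u hlam ht, ?_⟩
  rintro G' hG' hreal ⟨lam, t⟩ ⟨hlam, ht⟩
  have hslice : ∀ {G : ℂ × (Fin (n + 1) → ℂ) → ℂ},
      DifferentiableOn ℂ G (HypCM.Lam 1 ×ˢ HypCM.domA (n + 1)) →
        DifferentiableOn ℂ (fun t => G (lam, t)) (HypCM.domA (n + 1)) := fun hG =>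
    hG.comp (f := fun t => (lam, t)) (by fun_prop) fun t ht => ⟨hlam, ht⟩
  refine HypCM.eqOn_of_eq_ofReal (HypCM.isOpen_domA _) (HypCM.convex_domA _)
    (fun x j k _ => by simpa using Real.pi_pos) (hslice hG')
    (hslice (HypCM.differentiableOn_extF u)) (fun x => ?_) ht
  rw [hreal lam hlam x, HypCM.extF_eq_F u hlam (HypCM.ofReal_mem_polystrip x)]
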